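/- Let $P$ be a finite graded simplicial poset of rank $n\ge 0$, that is, a finite poset with a least element $\hat 0$ such that every maximal interval $[\hat 0,m]$ ($m$ a maximal element of $P$) is isomorphic to the Boolean lattice of rank $n$. Let $f_{i-1}$ be the number of elements of rank $i$ of $P$, and define the $h$-vector $(h_0,\dots,h_n)$ of $P$ by $\sum_{i=0}^n h_i x^i=\sum_{i=0}^n f_{i-1}x^i(1-x)^{n-i}$. Let $\widehat P$ be $P$ with a new top element $\hat 1$ added. For $T\subseteq\{1,\dots,n\}$ let $\alpha_{\widehat P}(T)$ be the number of maximal chains of the subposet of $\widehat P$ formed by the elements whose rank lies in $T$, and for $S\subseteq\{1,\dots,n\}$ put $\beta_{\widehat P}(S)=\sum_{T\subseteq S}(-1)^{|S\setminus T|}\alpha_{\widehat P}(T)$. Call $S$ isolated if $i\in S$ implies $i+1\notin S$. The Chow polynomial and the augmented Chow polynomial of $\widehat P$ are $$\operatorname{H}_{\widehat P}(x)=\sum_{\substack{S\subseteq\{2,\dots,n\}\\ S\text{ isolated}}}\beta_{\widehat P}(S)\,x^{|S|}(1+x)^{n-2|S|},\qquad \operatorname{H}^{\mathrm{aug}}_{\widehat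 P}(x)=\sum_{\substack{S\subseteq\{1,\dots,n\}\\ S\text{ isolated}}}\beta_{\widehat P}(S)\,x^{|S|}(1+x)^{n+1-2|S|}.$$ **Theorem.** If $h_i\ge 0$ for all $0\le i\le n$, then $\operatorname{H}_{\widehat P}(x)$ and $\operatorname{H}^{\mathrm{aug}}_{\widehat P}(x)$ are real-rooted, that is, all their complex roots are real. -/

import Mathlib

open Polynomial

noncomputable section

namespace ChowPoset

/-- The elements of a poset `Q` with a least element whose rank lies in `T`.  The rank of `x` is the
largest length of a chain ending in `x`, which is `Order.height x`. -/
def RankSelected (Q : Type*) [PartialOrder Q] (T : Finset ℕ) : Set Q :=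
  {x | ∃ i ∈ T, Order.height x = (i : ℕ∞)}

/-- Flag `f`-vector: the number of maximal chains of the subposet of `Q` formed by the elements with
rank in `T` (mathlib's `Flag` is the type of maximal chains). -/
def flagF (Q : Type*) [PartialOrder Q] (T : Finset ℕ) : ℕ :=
  Nat.card (Flag (RankSelected Q T))

/-- Flag `h`-vector: `β(S) = ∑_{T ⊆ S} (-1)^{|S \ T|} α(T)`. -/
def flagH (Q : Type*) [PartialOrder Q] (S : Finset ℕ) : ℤ :=
  ∑ T ∈ S.powerset, (-1) ^ (S \ T).card * (flagF Q T : ℤ)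

/-- A set of integers is isolated if it contains no two consecutive elements. -/
def Isolated (S : Finset ℕ) : Prop := ∀ i ∈ S, i + 1 ∉ S

open Classical in
/-- The Chow polynomial of a bounded graded poset `Q` of rank `n + 1`. -/
def chowPolynomial (Q : Type*) [PartialOrder Q] (n : ℕ) : ℝ[X] :=
  ∑ S ∈ (Finset.Icc 2 n).powerset with Isolated S,
    C (flagH Q S : ℝ) * X ^ S.card * (1 + X) ^ (n - 2 * S.card)

open Classical in
/-- The augmented Chow polynomial of a bounded graded poset `Q` of rank `n + 1`. -/
def augChowPolynomial (Q : Type*) [PartialOrder Q] (n : ℕ) : ℝ[X] :=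
  ∑ S ∈ (Finset.Icc 1 n).powerset with Isolated S,
    C (flagH Q S : ℝ) * X ^ S.card * (1 + X) ^ (n + 1 - 2 * S.card)

/-- `P` (with least element `⊥`) is graded simplicial of rank `n`: all its maximal intervals, which
are the intervals from `⊥` to a maximal element, are boolean of rank `n`. -/
def IsGradedSimplicial (P : Type*) [PartialOrder P] [OrderBot P] (n : ℕ) : Prop :=
  ∀ m : P, IsMax m → Nonempty (Set.Icc (⊥ : P) m ≃o Finset (Fin n))

/-- The number `f_{i-1}` of elements of rank `i`. -/
def rankCount (P : Type*) [PartialOrder P] (i : ℕ) : ℕ :=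
  Nat.card {x : P // Order.height x = (i : ℕ∞)}

/-- `h_0 + h_1 x + ⋯ + h_n x^n = ∑_{i=0}^n f_{i-1} x^i (1-x)^{n-i}`. -/
def hPolynomial (P : Type*) [PartialOrder P] (n : ℕ) : ℤ[X] :=
  ∑ i ∈ Finset.range (n + 1), C (rankCount P i : ℤ) * X ^ i * (1 - X) ^ (n - i)

/-- The entry `h_i` of the `h`-vector of a graded simplicial poset `P` of rank `n`. -/
def hVector (P : Type*) [PartialOrder P] (n i : ℕ) : ℤ := (hPolynomial P n).coeff i

/-- A real polynomial is real-rooted if all of its complex roots are real.  (The zero polynomial is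
not real-rooted in this sense.) -/
def RealRooted (p : ℝ[X]) : Prop := ∀ z : ℂ, aeval z p = 0 → z.im = 0

end ChowPoset

end

/-! The flag numbers are linear in the h-vector, with coefficients obeying a recursion in the rank
that preserves interlacing.

A maximal chain with ranks in T is an element of the largest rank t of T together with a maximal
chain in the Boolean lattice below it, and f_{t-1} = ∑_j h_j C(n-j, n-t). Hence β(S) = ∑_j h_j
d_{n,j}(S) with d = `descentCoeff`. For j ≤ n+1, d_{n+1,j}(S) is the sum of d_{n,i}(S \ {n+1}) over
i ≥ j if n+1 ∉ S and over i < j if n+1 ∈ S, as for permutations refined by descent set and last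
letter.

Put y = z/(1+z)². At z each polynomial is a power of 1+z times ∑_S β(S) y^|S|, and a non-real z
makes y non-real or positive, so it suffices that this sum does not vanish for such y. For y > 0 all
terms are nonnegative and one is positive. For y non-real, let A_j and D_j be the sums of d_{n,j}(S)
y^|S| over isolated S without and with n. The recursion reads A'_j = ∑_{i≥j} (A_i + D_i), D'_j = y
∑_{i<j} A_i, and `Interlaced.step` shows that it preserves interlacing. Interlacing is tested at the
single point y by `Precedes`, which is additive in each argument, so neither transitivity nor a
separate treatment of zero polynomials is needed. Since h_0 = 1, the final sum is A_0 + D_0 plus a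
term it precedes, which cannot vanish (`Interlaced.sum_ne_zero`). -/

namespace ChowPoset

/-! ### Boolean lower intervals and ranks -/

/-- The elements below a member of a lower interval form the same poset as in the ambient order. -/
def iicSubtypeIso {Q : Type*} [PartialOrder Q] {U : Set Q} [hU : U.OrdConnected] {b : Q}
    (hb : b ∈ U) (hmin : ∀ x, b ≤ x) (x : U) : Set.Iic x ≃o Set.Iic (x : Q) where
  toFun y := ⟨y.1.1, y.2⟩
  invFun y := ⟨⟨y.1, hU.out hb x.2 ⟨hmin _, y.2⟩⟩, y.2⟩
  left_inv _ := rfl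
  right_inv _ := rfl
  map_rel_iff' := Iff.rfl

/-- An order isomorphism restricts to the elements below a given one. -/
def iicCongr {α β : Type*} [PartialOrder α] [PartialOrder β] (e : α ≃o β) (x : α) :
    Set.Iic x ≃o Set.Iic (e x) where
  toFun y := ⟨e y.1, e.monotone y.2⟩
  invFun y := ⟨e.symm y.1, by simpa using e.symm.monotone y.2⟩
  left_inv y := by simp
  right_inv y := by simp
  map_rel_iff' {a b} := e.le_iff_le (x := a.1) (y := b.1)

/-- The subsets of `s` form a Boolean lattice. -/
noncomputable def iicFinsetIso {n : ℕ} (s : Finset (Fin n)) :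
    Set.Iic s ≃o Finset (Fin s.card) where
  toFun u := u.1.preimage (s.orderEmbOfFin rfl) (s.orderEmbOfFin rfl).injective.injOn
  invFun v := ⟨v.map (s.orderEmbOfFin rfl).toEmbedding, fun a ha => by
    simp only [Finset.mem_map] at ha
    obtain ⟨i, -, rfl⟩ := ha
    exact Finset.orderEmbOfFin_mem s rfl i⟩
  left_inv u := by
    ext a
    simp only [Finset.mem_map, Finset.mem_preimage]
    refine ⟨?_, fun ha => ?_⟩
    · rintro ⟨i, hi, rfl⟩
      exact hi
    · obtain ⟨i, rfl⟩ : a ∈ Set.range (s.orderEmbOfFin rfl) := by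
        rw [Finset.range_orderEmbOfFin]; exact u.2 ha
      exact ⟨i, ha, rfl⟩
  right_inv v := by
    ext i
    simp
  map_rel_iff' {u v} := by
    refine ⟨fun h a ha => ?_, fun h i hi => ?_⟩
    · obtain ⟨i, rfl⟩ : a ∈ Set.range (s.orderEmbOfFin rfl) := by
        rw [Finset.range_orderEmbOfFin]; exact u.2 ha
      have hi : i ∈ u.1.preimage (s.orderEmbOfFin rfl)
        (s.orderEmbOfFin rfl).injective.injOn := by simpa using ha
      simpa using h hi
    · have hi' : s.orderEmbOfFin rfl i ∈ u.1 := by simpa using hi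
      simpa using h hi'

theorem height_Iic {Q : Type*} [PartialOrder Q] {x : Q} (y : Set.Iic x) :
    Order.height y = Order.height (y : Q) :=
  Order.height_eq_of_strictMono (Subtype.val : Set.Iic x → Q) (fun _ _ h => h)
    (fun a b hb => ⟨⟨b, hb.le.trans a.2⟩, hb, rfl⟩) y

theorem height_finset {n : ℕ} (s : Finset (Fin n)) : Order.height s = s.card := by
  apply le_antisymm
  · have h := Order.height_le_height_apply_of_strictMono (Finset.card : Finset (Fin n) → ℕ)
      Finset.card_strictMono s
    simpa using h
  · induction s using Finset.induction_on with
    | empty => simp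
    | insert a s ha ih =>
      rw [Finset.card_insert_of_notMem ha]
      push_cast
      refine le_trans (by gcongr) (Order.height_add_one_le (Finset.ssubset_insert ha))

theorem height_eq_of_iso {Q : Type*} [PartialOrder Q] {x : Q} {k : ℕ}
    (e : Set.Iic x ≃o Finset (Fin k)) : Order.height x = k := by
  have h : e (⊤ : Set.Iic x) = ⊤ := map_top e
  have h2 := Order.height_orderIso e ⊤
  rw [h, height_finset, height_Iic] at h2
  simpa using h2.symm

/-- By finiteness p lies below a maximal element m. In the Boolean interval below m, rank is
cardinality, and enlarging the subset of p gives elements above p of every rank up to n. -/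
theorem IsGradedSimplicial.exists_iso {P : Type*} [PartialOrder P] [OrderBot P] [Finite P] {n : ℕ}
    (hP : IsGradedSimplicial P n) (p : P) :
    ∃ k ≤ n, Order.height p = k ∧ Nonempty (Set.Iic p ≃o Finset (Fin k)) ∧
      ∀ t, k ≤ t → t ≤ n → ∃ x, p ≤ x ∧ Order.height x = t := by
  obtain ⟨m, hpm, hm⟩ := (Set.toFinite (Set.univ : Set P)).exists_le_maximal (Set.mem_univ p)
  obtain ⟨e⟩ := hP m (fun b hb => hm.2 (Set.mem_univ b) hb)
  have key : ∀ q : Set.Icc (⊥ : P) m, Nonempty (Set.Iic (q : P) ≃o Finset (Fin (e q).card)) :=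
    fun q => ⟨(iicSubtypeIso (U := Set.Icc ⊥ m) (Set.left_mem_Icc.2 bot_le)
      (fun _ => bot_le) q).symm.trans ((iicCongr e q).trans (iicFinsetIso (e q)))⟩
  let q : Set.Icc (⊥ : P) m := ⟨p, bot_le, hpm⟩
  refine ⟨(e q).card, by simpa using Finset.card_le_univ (e q),
    height_eq_of_iso (key q).some, key q, fun t ht htn => ?_⟩
  obtain ⟨u, hu, -, rfl⟩ := Finset.exists_subsuperset_card_eq (Finset.subset_univ (e q)) ht
    (by simpa using htn)
  refine ⟨e.symm u, ?_, ?_⟩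
  · have : q ≤ e.symm u := by rw [OrderIso.le_symm_apply]; exact hu
    exact this
  · have := height_eq_of_iso (key (e.symm u)).some
    rwa [e.apply_symm_apply] at this

theorem isGradedSimplicial_finset (n : ℕ) : IsGradedSimplicial (Finset (Fin n)) n := by
  intro m hm
  obtain rfl : m = ⊤ := hm.eq_top
  rw [show Set.Icc (⊥ : Finset (Fin n)) ⊤ = Set.univ by ext; simp]
  exact ⟨OrderIso.Set.univ⟩

theorem rankCount_finset (n t : ℕ) : rankCount (Finset (Fin n)) t = n.choose t := by
  unfold rankCount
  simp only [height_finset, Nat.cast_inj]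
  rw [Nat.card_eq_fintype_card, Fintype.card_finset_len, Fintype.card_fin]

/-! ### Maximal chains of rank-selected subposets -/

theorem flagF_congr {Q R : Type*} [PartialOrder Q] [PartialOrder R] {T : Finset ℕ}
    (e : RankSelected Q T ≃o RankSelected R T) : flagF Q T = flagF R T :=
  Nat.card_congr (Flag.map e)

theorem flagF_empty (Q : Type*) [PartialOrder Q] : flagF Q ∅ = 1 := by
  have : IsEmpty (RankSelected Q ∅) := ⟨fun x => by simpa [RankSelected] using x.2⟩
  unfold flagF
  rw [Nat.card_eq_one_iff_unique]
  refine ⟨⟨fun a b => Flag.ext (Subsingleton.elim _ _)⟩, ⟨⟨∅, by simp, fun s _ _ => ?_⟩⟩⟩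
  exact Subsingleton.elim _ _

theorem IsGradedSimplicial.flagF_withTop {P : Type*} [PartialOrder P] [OrderBot P] [Finite P]
    {n : ℕ} (hP : IsGradedSimplicial P n) {T : Finset ℕ} (hT : ∀ i ∈ T, i ≤ n) :
    flagF (WithTop P) T = flagF P T := by
  have htop : (⊤ : WithTop P) ∉ RankSelected (WithTop P) T := by
    rintro ⟨i, hi, h⟩
    obtain ⟨k, hk, -, -, h3⟩ := hP.exists_iso (⊥ : P)
    obtain ⟨x, -, hx⟩ := h3 n hk le_rfl
    -- An element of rank n lies strictly below `⊤`, so the height of `⊤` exceeds every member of T.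
    have h1 := Order.height_add_one_le (WithTop.coe_lt_top x)
    rw [Order.height_coe_withTop, hx, h] at h1
    have := hT i hi
    norm_cast at h1
    omega
  have hmem : ∀ x : P, (x : WithTop P) ∈ RankSelected (WithTop P) T ↔ x ∈ RankSelected P T :=
    fun x => by simp [RankSelected]
  let f : RankSelected P T → RankSelected (WithTop P) T := fun x => ⟨x.1, (hmem _).2 x.2⟩
  have hf : ∀ {x y}, f x ≤ f y ↔ x ≤ y := fun {x y} => by
    simp [f, ← Subtype.coe_le_coe]
  refine (flagF_congr ⟨Equiv.ofBijective f ⟨fun x y h => ?_, fun ⟨x, hx⟩ => ?_⟩, hf⟩).symm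
  · exact le_antisymm (hf.1 h.le) (hf.1 h.ge)
  · induction x with
    | top => exact absurd hx htop
    | coe x => exact ⟨⟨x, (hmem x).1 hx⟩, rfl⟩

/-- `s` is a maximal chain of the subposet `U`. -/
def IsFlagIn {Q : Type*} [PartialOrder Q] (U s : Set Q) : Prop :=
  s ⊆ U ∧ ∀ a ∈ U, a ∈ s ↔ ∀ b ∈ s, a ≤ b ∨ b ≤ a

theorem card_flag_eq {Q : Type*} [PartialOrder Q] (U : Set Q) :
    Nat.card (Flag U) = Nat.card {s : Set Q // IsFlagIn U s} := by
  refine Nat.card_congr (Equiv.ofBijective (fun c => ⟨Subtype.val '' (c : Set U), ?_, ?_⟩) ⟨?_, ?_⟩)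
  · rintro _ ⟨a, -, rfl⟩
    exact a.2
  · intro a ha
    have h := Flag.mem_iff_forall_le_or_ge (s := c) (a := ⟨a, ha⟩)
    simpa [ha] using h
  · intro c d h
    apply Flag.ext
    exact Subtype.val_injective.image_injective (Subtype.ext_iff.1 h)
  · rintro ⟨s, hs, h⟩
    refine ⟨⟨Subtype.val ⁻¹' s, ?_, ?_⟩, ?_⟩
    · intro a ha b hb _
      exact (h a a.2).1 ha b hb
    · intro r hr hsr
      refine hsr.antisymm fun a ha => (h a a.2).2 fun b hb => ?_
      exact hr.total ha (hsr (show (⟨b, hs hb⟩ : U) ∈ _ from hb))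
    · ext a
      exact ⟨fun ⟨b, hb, hba⟩ => hba ▸ hb, fun ha => ⟨⟨a, hs ha⟩, ha, rfl⟩⟩

/-- The bijection removes the top element x of the chain. Purity is what makes it surjective: a
chain with no element of rank t could be extended by one, so a maximal chain contains one. -/
theorem IsGradedSimplicial.card_flagIn_insert {P : Type*} [PartialOrder P] [OrderBot P] [Finite P]
    {n t : ℕ} (hP : IsGradedSimplicial P n) {T : Finset ℕ} (hT : ∀ i ∈ T, i < t) (htn : t ≤ n) :
    Nat.card {s : Set P // IsFlagIn (RankSelected P (insert t T)) s} =
      Nat.card (Σ x : {x : P // Order.height x = (t : ℕ∞)},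
        {d : Set P // IsFlagIn (RankSelected P T ∩ Set.Iic x.1) d}) := by
  have hlt : ∀ {x : P}, x ∈ RankSelected P T → Order.height x < (t : ℕ∞) := by
    rintro x ⟨i, hi, h⟩
    rw [h]
    exact_mod_cast hT i hi
  have heq : ∀ {x y : P}, x ≤ y → Order.height x = (t : ℕ∞) → Order.height y ≤ (t : ℕ∞) →
      x = y := by
    intro x y hxy hx hy
    by_contra hne
    have h1 := Order.height_strictMono (lt_of_le_of_ne hxy hne) (by rw [hx]; exact ENat.natCast_lt_top t)
    rw [hx] at h1
    exact h1.not_ge hy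
  have hsplit : ∀ {x : P}, x ∈ RankSelected P (insert t T) ↔
      Order.height x = (t : ℕ∞) ∨ x ∈ RankSelected P T := by
    intro x
    simp [RankSelected]
  have hle : ∀ {x : P}, x ∈ RankSelected P (insert t T) → Order.height x ≤ (t : ℕ∞) := by
    intro x hx
    rcases hsplit.1 hx with h | h
    exacts [h.le, (hlt h).le]
  symm
  refine Nat.card_congr (Equiv.ofBijective (fun p => ⟨insert p.1.1 p.2.1, ?_, ?_⟩) ⟨?_, ?_⟩)
  · obtain ⟨⟨x, hx⟩, d, hd, h⟩ := p
    rintro a (rfl | ha)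
    exacts [hsplit.2 (Or.inl hx), hsplit.2 (Or.inr (hd ha).1)]
  · obtain ⟨⟨x, hx⟩, d, hd, h⟩ := p
    intro a ha
    refine ⟨?_, fun hab => ?_⟩
    · rintro (rfl | had) b (rfl | hbd)
      · exact Or.inl le_rfl
      · exact Or.inr (hd hbd).2
      · exact Or.inl (hd had).2
      · exact (h a (hd had)).1 had b hbd
    · rcases hab x (Set.mem_insert _ _) with hax | hxa
      · rcases hsplit.1 ha with h1 | h1
        · exact Or.inl (heq hax h1 hx.le)
        · exact Or.inr ((h a ⟨h1, hax⟩).2 fun b hb => hab b (Set.mem_insert_of_mem _ hb))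
      · exact Or.inl (heq hxa hx (hle ha)).symm
  · rintro ⟨⟨x, hx⟩, d, hd, h⟩ ⟨⟨y, hy⟩, e, he, h'⟩ hxy
    have hxy : insert x d = insert y e := Subtype.ext_iff.1 hxy
    have hxd : x ∉ d := fun hm => (hlt (hd hm).1).ne hx
    have hye : y ∉ e := fun hm => (hlt (he hm).1).ne hy
    obtain rfl : x = y := by
      have : x ∈ insert y e := hxy ▸ Set.mem_insert _ _
      rcases this with h | hm
      · exact h
      · exact absurd hx (hlt (he hm).1).ne
    obtain rfl : d = e := by
      rw [← Set.insert_sdiff_self_of_notMem hxd, hxy, Set.insert_sdiff_self_of_notMem hye]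
    rfl
  · rintro ⟨s, hs, h⟩
    -- y is the top of the chain, or `⊥` if the chain is empty; an element of rank t above y is
    -- comparable with the whole chain, hence already in it.
    obtain ⟨y, hyt, hy⟩ : ∃ y : P, Order.height y ≤ (t : ℕ∞) ∧ ∀ b ∈ s, b ≤ y := by
      rcases s.eq_empty_or_nonempty with rfl | hne
      · exact ⟨⊥, by simp, by simp⟩
      · obtain ⟨y, hy⟩ := s.toFinite.exists_maximal hne
        refine ⟨y, hle (hs hy.1), fun b hb => ?_⟩
        rcases (h b (hs hb)).1 hb y hy.1 with h1 | h1
        exacts [h1, hy.2 hb h1]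
    obtain ⟨k, -, hk, -, hex⟩ := hP.exists_iso y
    obtain ⟨x, hyx, hx⟩ := hex t (by rw [hk] at hyt; exact_mod_cast hyt) htn
    have hxs : x ∈ s := (h x (hsplit.2 (Or.inl hx))).2 fun b hb => Or.inr ((hy b hb).trans hyx)
    have hxx : ∀ {b}, b ∈ RankSelected P T → b ≠ x := by
      rintro b hb rfl
      exact (hlt hb).ne hx
    refine ⟨⟨⟨x, hx⟩, s \ {x}, ?_, ?_⟩, ?_⟩
    · rintro b ⟨hb, hbx⟩
      refine ⟨(hsplit.1 (hs hb)).resolve_left fun h1 => hbx ?_, (hy b hb).trans hyx⟩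
      exact heq ((hy b hb).trans hyx) h1 hx.le
    · rintro a ⟨haT, hax⟩
      refine ⟨fun ha b hb => (h a (hs ha.1)).1 ha.1 b hb.1, fun hab => ⟨?_, hxx haT⟩⟩
      refine (h a (hsplit.2 (Or.inr haT))).2 fun b hb => ?_
      by_cases hbx : b = x
      · exact Or.inl (hbx ▸ hax)
      · exact hab b ⟨hb, hbx⟩
    · exact Subtype.ext (Set.insert_sdiff_self_of_mem hxs)

theorem card_flagIn_inter_Iic {P : Type*} [PartialOrder P] {t : ℕ} {x : P} {T : Finset ℕ}
    (e : Set.Iic x ≃o Finset (Fin t)) :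
    Nat.card {d : Set P // IsFlagIn (RankSelected P T ∩ Set.Iic x) d} =
      flagF (Finset (Fin t)) T := by
  rw [← card_flag_eq]
  have hmem : ∀ y : Set.Iic x, e y ∈ RankSelected (Finset (Fin t)) T ↔ y.1 ∈ RankSelected P T := by
    intro y
    simp only [RankSelected, Set.mem_ofPred_eq, Order.height_orderIso, height_Iic]
  refine Nat.card_congr (Flag.map ⟨⟨fun y => ⟨e ⟨y.1, y.2.2⟩, (hmem _).2 y.2.1⟩,
    fun z => ⟨(e.symm z.1).1, (hmem _).1 (by simp), (e.symm z.1).2⟩, ?_, ?_⟩, ?_⟩)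
  · intro y; simp
  · intro z; simp
  · intro y z; exact e.le_iff_le (x := ⟨y.1, y.2.2⟩) (y := ⟨z.1, z.2.2⟩)

theorem IsGradedSimplicial.flagF_insert {P : Type*} [PartialOrder P] [OrderBot P] [Finite P]
    {n t : ℕ} (hP : IsGradedSimplicial P n) {T : Finset ℕ} (hT : ∀ i ∈ T, i < t) (htn : t ≤ n) :
    flagF P (insert t T) = rankCount P t * flagF (Finset (Fin t)) T := by
  have : ∀ x : {x : P // Order.height x = (t : ℕ∞)},
      Nat.card {d : Set P // IsFlagIn (RankSelected P T ∩ Set.Iic x.1) d} =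
        flagF (Finset (Fin t)) T := by
    rintro ⟨x, hx⟩
    obtain ⟨k, -, hk, ⟨e⟩, -⟩ := hP.exists_iso x
    obtain rfl : k = t := by rw [hx] at hk; exact_mod_cast hk.symm
    exact card_flagIn_inter_Iic e
  have hfin := Fintype.ofFinite {x : P // Order.height x = (t : ℕ∞)}
  rw [flagF, card_flag_eq, hP.card_flagIn_insert hT htn, Nat.card_sigma, Finset.sum_congr rfl
    fun x _ => this x, Finset.sum_const, smul_eq_mul, rankCount, Finset.card_univ,
    Nat.card_eq_fintype_card]

/-! ### Expansion of the flag f-vector in the h-vector -/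

/-- The contribution of `h_j` to the flag `f`-vector of a simplicial poset of rank `n`. -/
def chainCoeff : ℕ → ℕ → Finset ℕ → ℤ
  | 0, j, _ => if j = 0 then 1 else 0
  | n + 1, j, T =>
    if n + 1 ∈ T then ∑ i ∈ Finset.range (n + 1), chainCoeff n i T
    else ∑ i ∈ Finset.Ico j (n + 1), chainCoeff n i T

theorem sum_Ico_choose_sub {n t j : ℕ} (ht : t ≤ n) :
    ∑ i ∈ Finset.Ico j (n + 1), (n - i).choose (n - t) = (n + 1 - j).choose (n + 1 - t) := by
  rw [Finset.sum_Ico_reflect (fun i => i.choose (n - t)) j le_rfl, Nat.sub_self,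
    ← Finset.range_eq_Ico, show n + 1 - t = n - t + 1 by omega]
  induction n + 1 - j with
  | zero => simp
  | succ k ih => rw [Finset.sum_range_succ, ih, Nat.choose_succ_succ, add_comm]

/-- Above the largest rank in T only the tail-sum branch of the recursion applies, and iterating it
from a constant gives binomial coefficients by the hockey-stick identity. -/
theorem chainCoeff_eq_choose {n t : ℕ} (htn : t ≤ n) {T : Finset ℕ} (hT : ∀ i ∈ T, i ≤ t) {N : ℤ}
    (hN : ∀ j ≤ t, chainCoeff t j T = N) :
    ∀ j ≤ n, chainCoeff n j T = ((n - j).choose (n - t) : ℕ) * N := by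
  induction n, htn using Nat.le_induction with
  | base => intro j hj; simp [hN j hj]
  | succ n hn ih =>
    intro j _
    have hnT : n + 1 ∉ T := fun h => by have := hT _ h; omega
    rw [chainCoeff, if_neg hnT, ← sum_Ico_choose_sub hn, Nat.cast_sum, Finset.sum_mul]
    exact Finset.sum_congr rfl fun i hi => ih i (by simp at hi; omega)

theorem chainCoeff_empty {n j : ℕ} (hj : j ≤ n) : chainCoeff n j ∅ = if j = 0 then 1 else 0 := by
  rw [chainCoeff_eq_choose (t := 0) (N := 1) (Nat.zero_le n) (by simp) (by simp [chainCoeff]) j hj]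
  rcases Nat.eq_zero_or_pos j with rfl | h
  · simp
  · rw [Nat.choose_eq_zero_of_lt (by omega), if_neg h.ne']
    simp

theorem chainCoeff_insert {n : ℕ} (m : ℕ) (hm : n < m) (j : ℕ) (T : Finset ℕ) :
    chainCoeff n j (insert m T) = chainCoeff n j T := by
  induction n generalizing j with
  | zero => rfl
  | succ n ih =>
    have : n + 1 ∈ insert m T ↔ n + 1 ∈ T := by
      rw [Finset.mem_insert]
      exact or_iff_right (by omega)
    simp only [chainCoeff, this, ih (by omega)]

theorem chainCoeff_insert_self {t : ℕ} (ht : 1 ≤ t) (j : ℕ) {T : Finset ℕ} (hT : t ∉ T) :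
    chainCoeff t j (insert t T) = chainCoeff t 0 T := by
  obtain ⟨t, rfl⟩ := Nat.exists_eq_add_of_le' ht
  simp [chainCoeff, hT, chainCoeff_insert]

theorem exists_eq_insert_max {T : Finset ℕ} (hT : T.Nonempty) :
    ∃ t S, t ∉ S ∧ (∀ i ∈ S, i < t) ∧ T = insert t S := by
  refine ⟨T.max' hT, T.erase (T.max' hT), by simp, fun i hi => ?_,
    (Finset.insert_erase (T.max'_mem hT)).symm⟩
  exact T.lt_max'_of_mem_erase_max' hT hi

/-- The Boolean lattice has h-vector (1, 0, …, 0), so only j = 0 contributes. -/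
theorem flagF_finset {T : Finset ℕ} : ∀ {n : ℕ}, T ⊆ Finset.Icc 1 n →
    (flagF (Finset (Fin n)) T : ℤ) = chainCoeff n 0 T := by
  induction T using Finset.induction_on_max with
  | empty => intro n _; rw [flagF_empty, chainCoeff_empty (Nat.zero_le n)]; simp
  | insert t T hlt ih =>
    intro n hn
    rw [Finset.insert_subset_iff] at hn
    obtain ⟨ht1, htn⟩ := Finset.mem_Icc.1 hn.1
    have htT : t ∉ T := fun h => (hlt t h).false
    rw [(isGradedSimplicial_finset n).flagF_insert hlt htn, rankCount_finset, Nat.cast_mul,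
      ih (n := t) (fun i hi => Finset.mem_Icc.2 ⟨(Finset.mem_Icc.1 (hn.2 hi)).1, (hlt i hi).le⟩),
      chainCoeff_eq_choose htn (N := chainCoeff t 0 T) ?_
        (fun j _ => chainCoeff_insert_self ht1 j htT) 0 (Nat.zero_le n), Nat.sub_zero,
      Nat.choose_symm htn]
    simp only [Finset.mem_insert]
    rintro i (rfl | hi)
    exacts [le_rfl, (hlt i hi).le]

/-- Homogenizing X^i (1-X)^m in degree i+m and evaluating at (X, 1+X) turns the factor 1-X into
(1+X)-X = 1. This inverts the passage from the f-vector to the h-vector. -/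
theorem sum_coeff_X_pow_mul_one_sub_X_pow (i m : ℕ) :
    ∑ j ∈ Finset.range (i + m + 1),
      C ((X ^ i * (1 - X) ^ m : ℤ[X]).coeff j) * X ^ j * (1 + X) ^ (i + m - j) = X ^ i := by
  have hc : ∀ k, ((1 - X : ℤ[X]) ^ m).coeff k = (-1) ^ k * (m.choose k : ℤ) := by
    intro k
    have h : (1 - X : ℤ[X]) ^ m = ((1 + X : ℤ[X]) ^ m).comp (C (-1) * X) := by
      simp [sub_eq_add_neg]
    rw [h, comp_C_mul_X_coeff, coeff_one_add_X_pow]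
    ring
  rw [add_assoc, Finset.sum_range_add, Finset.sum_eq_zero, zero_add]
  · calc _ = X ^ i * ∑ k ∈ Finset.range (m + 1), (-X) ^ k * (1 + X) ^ (m - k) * (m.choose k : ℤ[X]) := by
          rw [Finset.mul_sum]
          refine Finset.sum_congr rfl fun k _ => ?_
          rw [coeff_X_pow_mul', if_pos (Nat.le_add_right i k), Nat.add_sub_cancel_left, hc,
            show i + m - (i + k) = m - k by omega, neg_pow (X : ℤ[X]) k]
          simp only [map_mul, map_pow, map_neg, map_one, map_natCast]
          ring
      _ = _ := by rw [← add_pow]; simp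
  · intro j hj
    rw [coeff_X_pow_mul', if_neg (by simpa using hj)]
    simp

theorem rankCount_eq_sum_hVector (P : Type*) [PartialOrder P] {n t : ℕ} (ht : t ≤ n) :
    (rankCount P t : ℤ) =
      ∑ j ∈ Finset.range (n + 1), hVector P n j * ((n - j).choose (n - t) : ℕ) := by
  have key : ∑ j ∈ Finset.range (n + 1), C (hVector P n j) * X ^ j * (1 + X) ^ (n - j) =
      ∑ i ∈ Finset.range (n + 1), C (rankCount P i : ℤ) * X ^ i := by
    simp only [hVector, hPolynomial, finsetSum_coeff, map_sum, Finset.sum_mul]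
    rw [Finset.sum_comm]
    refine Finset.sum_congr rfl fun i hi => ?_
    obtain ⟨m, rfl⟩ := Nat.exists_eq_add_of_le (Nat.lt_succ_iff.1 (Finset.mem_range.1 hi))
    refine Eq.trans ?_ (congrArg (C (rankCount P i : ℤ) * ·) (sum_coeff_X_pow_mul_one_sub_X_pow i m))
    simp only [Finset.mul_sum]
    refine Finset.sum_congr rfl fun j _ => ?_
    rw [mul_assoc (C _) (X ^ i), coeff_C_mul, C_mul, Nat.add_sub_cancel_left]
    ring
  have h2 := congrArg (fun p => coeff p t) key
  simp only [finsetSum_coeff, coeff_C_mul, mul_assoc, coeff_X_pow, mul_ite, mul_one, mul_zero,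
    Finset.sum_ite_eq, Finset.mem_range, Nat.lt_succ_iff.2 ht, if_true] at h2
  rw [← h2]
  refine Finset.sum_congr rfl fun j hj => ?_
  have hj := Finset.mem_range.1 hj
  rw [coeff_X_pow_mul']
  split_ifs with hjt
  · rw [coeff_one_add_X_pow, ← Nat.choose_symm (show t - j ≤ n - j by omega),
      show n - j - (t - j) = n - t by omega]
  · rw [Nat.choose_eq_zero_of_lt (by omega)]
    simp

theorem rankCount_zero (P : Type*) [PartialOrder P] [OrderBot P] :
    rankCount P 0 = 1 := by
  rw [rankCount, Nat.card_eq_one_iff_unique]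
  refine ⟨⟨fun a b => ?_⟩, ⟨⟨⊥, by simp⟩⟩⟩
  have h : ∀ x : {x : P // Order.height x = ((0 : ℕ) : ℕ∞)}, x.1 = ⊥ := fun x => by
    simpa using x.2
  exact Subtype.ext ((h a).trans (h b).symm)

theorem hVector_zero (P : Type*) [PartialOrder P] [OrderBot P] (n : ℕ) : hVector P n 0 = 1 := by
  have h := rankCount_eq_sum_hVector P (Nat.zero_le n)
  rw [rankCount_zero, Finset.sum_eq_single 0] at h
  · simpa using h.symm
  · intro j hj hj0
    rw [Nat.choose_eq_zero_of_lt (by have := Finset.mem_range.1 hj; omega)]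
    simp
  · simp

theorem IsGradedSimplicial.flagF_eq_sum {P : Type*} [PartialOrder P] [OrderBot P] [Finite P]
    {n : ℕ} (hP : IsGradedSimplicial P n) {T : Finset ℕ} (hT : T ⊆ Finset.Icc 1 n) :
    (flagF (WithTop P) T : ℤ) =
      ∑ j ∈ Finset.range (n + 1), hVector P n j * chainCoeff n j T := by
  rw [hP.flagF_withTop fun i hi => (Finset.mem_Icc.1 (hT hi)).2]
  rcases T.eq_empty_or_nonempty with rfl | hne
  · rw [flagF_empty, Finset.sum_eq_single 0]
    · simp [hVector_zero, chainCoeff_empty]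
    · intro j hj hj0
      rw [chainCoeff_empty (by have := Finset.mem_range.1 hj; omega), if_neg hj0, mul_zero]
    · simp
  · obtain ⟨t, S, htS, hlt, rfl⟩ := exists_eq_insert_max hne
    rw [Finset.insert_subset_iff] at hT
    obtain ⟨ht1, htn⟩ := Finset.mem_Icc.1 hT.1
    rw [hP.flagF_insert hlt htn, Nat.cast_mul,
      flagF_finset (n := t) (fun i hi => Finset.mem_Icc.2 ⟨(Finset.mem_Icc.1 (hT.2 hi)).1, (hlt i hi).le⟩),
      rankCount_eq_sum_hVector P htn, Finset.sum_mul]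
    refine Finset.sum_congr rfl fun j hj => ?_
    rw [chainCoeff_eq_choose htn (N := chainCoeff t 0 S) ?_
        (fun j _ => chainCoeff_insert_self ht1 j htS) j
        (by have := Finset.mem_range.1 hj; omega), mul_assoc]
    simp only [Finset.mem_insert]
    rintro i (rfl | hi)
    exacts [le_rfl, (hlt i hi).le]

/-! ### Interlacing tested at one non-real point -/

/-- The values `a`, `b` of two polynomials at a non-real `y` are compatible with the roots of the
first interlacing those of the second: `b / a` lies in the convex cone spanned by `1` and `y`. -/
def Precedes (y a b : ℂ) : Prop :=
  0 ≤ y.im * (b * star a).im ∧ 0 ≤ y.im * (y * a * star b).im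

theorem Precedes.refl (y a : ℂ) : Precedes y a a := by
  constructor
  · simp [mul_comm]
  · have : y.im * (y * a * star a).im = y.im ^ 2 * (a.re ^ 2 + a.im ^ 2) := by
      simp; ring
    rw [this]; positivity

theorem Precedes.zero_left (y b : ℂ) : Precedes y 0 b := by simp [Precedes]

theorem Precedes.zero_right (y a : ℂ) : Precedes y a 0 := by simp [Precedes]

theorem Precedes.add_right {y a b c : ℂ} (hb : Precedes y a b) (hc : Precedes y a c) :
    Precedes y a (b + c) := by
  refine ⟨?_, ?_⟩
  · rw [add_mul, Complex.add_im, mul_add]; exact add_nonneg hb.1 hc.1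
  · rw [star_add, mul_add, Complex.add_im, mul_add]; exact add_nonneg hb.2 hc.2

theorem Precedes.add_left {y a b c : ℂ} (ha : Precedes y a c) (hb : Precedes y b c) :
    Precedes y (a + b) c := by
  refine ⟨?_, ?_⟩
  · rw [star_add, mul_add, Complex.add_im, mul_add]; exact add_nonneg ha.1 hb.1
  · rw [mul_add, add_mul, Complex.add_im, mul_add]; exact add_nonneg ha.2 hb.2

theorem Precedes.sum_right {y a : ℂ} {ι : Type*} {s : Finset ι} {f : ι → ℂ}
    (h : ∀ i ∈ s, Precedes y a (f i)) : Precedes y a (∑ i ∈ s, f i) :=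
  Finset.sum_induction f (Precedes y a) (fun _ _ => Precedes.add_right) (Precedes.zero_right y a) h

theorem Precedes.sum_left {y b : ℂ} {ι : Type*} {s : Finset ι} {f : ι → ℂ}
    (h : ∀ i ∈ s, Precedes y (f i) b) : Precedes y (∑ i ∈ s, f i) b :=
  Finset.sum_induction f (Precedes y · b) (fun _ _ => Precedes.add_left) (Precedes.zero_left y b) h

theorem Precedes.mul_mul {y a b : ℂ} (h : Precedes y a b) : Precedes y (y * a) (y * b) := by
  have h1 : y.im * (y * b * star (y * a)).im = Complex.normSq y * (y.im * (b * star a).im) := by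
    simp [Complex.normSq_apply]; ring
  have h2 : y.im * (y * (y * a) * star (y * b)).im =
      Complex.normSq y * (y.im * (y * a * star b).im) := by
    simp [Complex.normSq_apply]; ring
  exact ⟨h1 ▸ mul_nonneg (Complex.normSq_nonneg y) h.1,
    h2 ▸ mul_nonneg (Complex.normSq_nonneg y) h.2⟩

/-- Pointwise form of the rule that if f interlaces g then g interlaces xf; the two defining
inequalities trade places up to the factor |y|². -/
theorem Precedes.swap_mul {y a b : ℂ} (h : Precedes y a b) : Precedes y b (y * a) := by
  refine ⟨h.2, ?_⟩
  have h1 : y.im * (y * b * star (y * a)).im = Complex.normSq y * (y.im * (b * star a).im) := by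
    simp [Complex.normSq_apply]; ring
  exact h1 ▸ mul_nonneg (Complex.normSq_nonneg y) h.1

theorem Precedes.smul_right {y a b : ℂ} (h : Precedes y a b) {r : ℝ} (hr : 0 ≤ r) :
    Precedes y a (r * b) := by
  have h1 : y.im * (r * b * star a).im = r * (y.im * (b * star a).im) := by
    simp; ring
  have h2 : y.im * (y * a * star (r * b)).im = r * (y.im * (y * a * star b).im) := by
    simp; ring
  exact ⟨h1 ▸ mul_nonneg hr h.1, h2 ▸ mul_nonneg hr h.2⟩

/-- For y non-real, -1 is not in the cone spanned by 1 and y. -/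
theorem Precedes.self_add_ne_zero {y a b : ℂ} (hy : y.im ≠ 0) (h : Precedes y a b) (ha : a ≠ 0) :
    a + b ≠ 0 := by
  intro hab
  obtain rfl : b = -a := (neg_eq_of_add_eq_zero_right hab).symm
  have h2 := h.2
  have : y.im * (y * a * star (-a)).im = -(y.im ^ 2 * Complex.normSq a) := by
    simp [Complex.normSq_apply]; ring
  rw [this] at h2
  have : 0 < y.im ^ 2 * Complex.normSq a :=
    mul_pos (by positivity) (Complex.normSq_pos.2 ha)
  linarith

/-- The invariant satisfied by the values at `y` of the generating functions `A j`, `D j` of the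
isolated sets, refined by the contribution `j` and by whether they contain the top rank. -/
structure Interlaced (y : ℂ) (m : ℕ) (A D : ℕ → ℂ) : Prop where
  left : ∀ i k, i ≤ k → k < m → Precedes y (A i) (A k)
  mixed : ∀ i k, i < m → k < m → Precedes y (A i) (D k)
  total : ∀ i k, i ≤ k → k < m → Precedes y (A i + D i) (A k + D k)
  ne_zero : A 0 + D 0 ≠ 0

theorem Interlaced.sum_ne_zero {y : ℂ} {m : ℕ} {A D : ℕ → ℂ} (hy : y.im ≠ 0)
    (h : Interlaced y (m + 1) A D) {r : ℕ → ℝ} (hr : ∀ j ≤ m, 0 ≤ r j) (hr0 : r 0 = 1) :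
    ∑ j ∈ Finset.range (m + 1), (r j : ℂ) * (A j + D j) ≠ 0 := by
  rw [Finset.sum_range_succ', hr0, Complex.ofReal_one, one_mul, add_comm]
  refine Precedes.self_add_ne_zero hy (Precedes.sum_right fun j hj => ?_) h.ne_zero
  have hj := Finset.mem_range.1 hj
  exact (h.total 0 (j + 1) (Nat.zero_le _) (by omega)).smul_right (hr _ (by omega))

/-- Additivity reduces each relation to pairs of old terms once the sums are cut at j and k. Write P
and Y for the sums of A_i + D_i and of A_i over j ≤ i < k; then A'_j = P + A'_k and D'_k = D'_j +
yY. -/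
theorem Interlaced.step {y : ℂ} {m : ℕ} {A D A' D' : ℕ → ℂ} (hy : y.im ≠ 0)
    (h : Interlaced y (m + 1) A D)
    (hA : ∀ j ≤ m + 1, A' j = ∑ i ∈ Finset.Ico j (m + 1), (A i + D i))
    (hD : ∀ j ≤ m + 1, D' j = y * ∑ i ∈ Finset.range j, A i) :
    Interlaced y (m + 2) A' D' := by
  have hsplit : ∀ j k, j ≤ k → k ≤ m + 1 →
      A' j = ∑ i ∈ Finset.Ico j k, (A i + D i) + A' k := by
    intro j k hjk hk
    rw [hA j (hjk.trans hk), hA k hk, Finset.sum_Ico_consecutive _ hjk hk]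
  have hsplit' : ∀ j k, j ≤ k → k ≤ m + 1 →
      D' k = D' j + y * ∑ i ∈ Finset.Ico j k, A i := by
    intro j k hjk hk
    rw [hD j (hjk.trans hk), hD k hk, ← mul_add, Finset.sum_range_add_sum_Ico _ hjk]
  have hPQ : ∀ j k, j ≤ k → k ≤ m + 1 →
      Precedes y (∑ i ∈ Finset.Ico j k, (A i + D i)) (A' k) := by
    intro j k hjk hk
    rw [hA k hk]
    refine Precedes.sum_left fun i hi => Precedes.sum_right fun l hl => ?_
    rw [Finset.mem_Ico] at hi hl
    exact h.total i l (by omega) (by omega)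
  have hYQ : ∀ k ≤ m + 1, ∀ s ⊆ Finset.range k,
      Precedes y (∑ i ∈ s, A i) (A' k) := by
    intro k hk s hs
    rw [hA k hk]
    refine Precedes.sum_left fun i hi => Precedes.sum_right fun l hl => ?_
    have hi := Finset.mem_range.1 (hs hi)
    rw [Finset.mem_Ico] at hl
    exact (h.left i l (by omega) (by omega)).add_right (h.mixed i l (by omega) (by omega))
  have hIco : ∀ j k, Finset.Ico j k ⊆ Finset.range k := fun j k i hi =>
    Finset.mem_range.2 (Finset.mem_Ico.1 hi).2
  have hYP : ∀ j k, j ≤ k → k ≤ m + 1 → ∀ s, s = Finset.range j ∨ s = Finset.Ico j k →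
      Precedes y (∑ i ∈ s, A i) (∑ i ∈ Finset.Ico j k, (A i + D i)) := by
    intro j k hjk hk s hs
    rw [Finset.sum_add_distrib]
    refine Precedes.add_right ?_ (Precedes.sum_left fun i hi => Precedes.sum_right fun l hl => ?_)
    · rcases hs with rfl | rfl
      · refine Precedes.sum_left fun i hi => Precedes.sum_right fun l hl => ?_
        rw [Finset.mem_range] at hi
        rw [Finset.mem_Ico] at hl
        exact h.left i l (by omega) (by omega)
      -- Over a common block the A_i cannot be compared termwise, since i may exceed l; the two
      -- block sums are equal, so reflexivity applies instead.
      · exact Precedes.refl _ _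
    · have hik : i < k := by
        rcases hs with rfl | rfl
        · exact (Finset.mem_range.1 hi).trans_le hjk
        · exact (Finset.mem_Ico.1 hi).2
      rw [Finset.mem_Ico] at hl
      exact h.mixed i l (by omega) (by omega)
  have hDself : ∀ j k, j ≤ k → k ≤ m + 1 →
      Precedes y (D' j) (y * ∑ i ∈ Finset.Ico j k, A i) := by
    intro j k hjk hk
    rw [hD j (hjk.trans hk)]
    refine Precedes.mul_mul (Precedes.sum_left fun i hi => Precedes.sum_right fun l hl => ?_)
    rw [Finset.mem_range] at hi
    rw [Finset.mem_Ico] at hl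
    exact h.left i l (by omega) (by omega)
  refine ⟨?_, ?_, ?_, ?_⟩
  · intro j k hjk hk
    rw [hsplit j k hjk (by omega)]
    exact (hPQ j k hjk (by omega)).add_left (Precedes.refl _ _)
  · intro k j hk hj
    rw [hD j (by omega)]
    refine Precedes.swap_mul ?_
    -- If k ≤ j the index ranges of the two sums overlap in the block from k to j, which has to be
    -- split off from both.
    rcases le_total j k with hjk | hkj
    · exact hYQ k (by omega) _ (Finset.range_subset_range.2 hjk)
    · rw [hsplit k j hkj (by omega), ← Finset.sum_range_add_sum_Ico _ hkj]
      refine (Precedes.add_left ?_ ?_).add_right (Precedes.add_left ?_ ?_)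
      · exact hYP k j hkj (by omega) _ (Or.inl rfl)
      · exact hYP k j hkj (by omega) _ (Or.inr rfl)
      · exact hYQ j (by omega) _ (Finset.range_subset_range.2 hkj)
      · exact hYQ j (by omega) _ (hIco k j)
  · intro j k hjk hk
    have hk : k ≤ m + 1 := by omega
    rw [hsplit j k hjk hk, hsplit' j k hjk hk, add_assoc, ← add_assoc (A' k)]
    -- The sums to compare are P + (A'_k + D'_j) and (A'_k + D'_j) + yY. The shared middle term
    -- precedes itself, and the remaining pairs are handled separately.
    refine Precedes.add_left (((hPQ j k hjk hk).add_right ?_).add_right ?_)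
      ((Precedes.refl _ _).add_right (Precedes.add_left ?_ (hDself j k hjk hk)))
    · rw [hD j (by omega)]
      exact (hYP j k hjk hk _ (Or.inl rfl)).swap_mul
    · exact (hYP j k hjk hk _ (Or.inr rfl)).swap_mul
    · exact (hYQ k hk _ (hIco j k)).swap_mul
  -- Since D'_0 = 0, the new value at index 0 is the sum of all old A_i + D_i, covered by
  -- `Interlaced.sum_ne_zero` with unit weights.
  · rw [hA 0 (Nat.zero_le _), hD 0 (Nat.zero_le _), Finset.range_zero, Finset.sum_empty, mul_zero,
      add_zero, ← Finset.range_eq_Ico]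
    simpa using h.sum_ne_zero hy (r := fun _ => 1) (fun _ _ => zero_le_one) rfl

/-! ### Expansion of the flag h-vector -/

/-- The contribution of `h_j` to the flag `h`-vector of a simplicial poset of rank `n`. -/
def descentCoeff (n j : ℕ) (S : Finset ℕ) : ℤ :=
  ∑ T ∈ S.powerset, (-1) ^ (S \ T).card * chainCoeff n j T

theorem descentCoeff_succ_of_notMem {n j : ℕ} {S : Finset ℕ} (hS : n + 1 ∉ S) :
    descentCoeff (n + 1) j S = ∑ i ∈ Finset.Ico j (n + 1), descentCoeff n i S := by
  simp only [descentCoeff]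
  rw [Finset.sum_comm]
  refine Finset.sum_congr rfl fun T hT => ?_
  rw [chainCoeff, if_neg fun h => hS (Finset.mem_powerset.1 hT h), Finset.mul_sum]

/-- In the alternating sum, subsets T containing n+1 contribute the full sum over i and those
avoiding it subtract the tail i ≥ j, leaving i < j. -/
theorem descentCoeff_succ_insert {n j : ℕ} (hj : j ≤ n + 1) {S : Finset ℕ} (hS : n + 1 ∉ S) :
    descentCoeff (n + 1) j (insert (n + 1) S) = ∑ i ∈ Finset.range j, descentCoeff n i S := by
  simp only [descentCoeff]
  rw [Finset.sum_powerset_insert hS, ← Finset.sum_add_distrib, Finset.sum_comm]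
  refine Finset.sum_congr rfl fun T hT => ?_
  have hT : n + 1 ∉ T := fun h => hS (Finset.mem_powerset.1 hT h)
  have h1 : (insert (n + 1) S \ T).card = (S \ T).card + 1 := by
    rw [Finset.insert_sdiff_of_notMem _ hT, Finset.card_insert_of_notMem (by simp [hS])]
  have h2 : insert (n + 1) S \ insert (n + 1) T = S \ T := by
    ext i
    simp only [Finset.mem_sdiff, Finset.mem_insert]
    grind
  have h3 := Finset.sum_range_add_sum_Ico (fun i => chainCoeff n i T) hj
  rw [h1, h2, chainCoeff_insert_self (Nat.le_add_left 1 n) j hT, chainCoeff, if_neg hT, chainCoeff,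
    if_neg hT, ← Finset.range_eq_Ico, ← h3, ← Finset.mul_sum]
  ring

theorem IsGradedSimplicial.flagH_eq_sum {P : Type*} [PartialOrder P] [OrderBot P] [Finite P]
    {n : ℕ} (hP : IsGradedSimplicial P n) {S : Finset ℕ} (hS : S ⊆ Finset.Icc 1 n) :
    flagH (WithTop P) S = ∑ j ∈ Finset.range (n + 1), hVector P n j * descentCoeff n j S := by
  simp only [flagH, descentCoeff, Finset.mul_sum]
  rw [Finset.sum_comm]
  refine Finset.sum_congr rfl fun T hT => ?_
  rw [hP.flagF_eq_sum ((Finset.mem_powerset.1 hT).trans hS), Finset.mul_sum]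
  exact Finset.sum_congr rfl fun j _ => by ring

theorem descentCoeff_empty {n j : ℕ} (hj : j ≤ n) :
    descentCoeff n j ∅ = if j = 0 then 1 else 0 := by
  simp [descentCoeff, chainCoeff_empty hj]

/-! ### Generating functions of isolated sets -/

open Classical in
/-- The isolated subsets of `{l, …, n}`. -/
noncomputable def isolatedSets (l n : ℕ) : Finset (Finset ℕ) :=
  (Finset.Icc l n).powerset.filter Isolated

theorem mem_isolatedSets {l n : ℕ} {S : Finset ℕ} :
    S ∈ isolatedSets l n ↔ S ⊆ Finset.Icc l n ∧ Isolated S := by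
  simp [isolatedSets]

theorem Isolated.mono {S T : Finset ℕ} (h : Isolated T) (hST : S ⊆ T) : Isolated S :=
  fun i hi hi' => h i (hST hi) (hST hi')

/-- S and S + 1 are disjoint subsets of {l, …, n+1}. The bound makes the truncated exponent n + 2 -
l - 2|S| an honest difference. -/
theorem two_mul_card_le_of_isolated {l n : ℕ} {S : Finset ℕ} (hS : S ∈ isolatedSets l n) :
    2 * S.card ≤ n + 2 - l := by
  obtain ⟨hS, hi⟩ := mem_isolatedSets.1 hS
  have hd : Disjoint S (S.map (addRightEmbedding 1)) := by
    rw [Finset.disjoint_left]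
    intro i hiS h
    obtain ⟨k, hk, rfl⟩ := Finset.mem_map.1 h
    exact hi k hk hiS
  have hsub : S ∪ S.map (addRightEmbedding 1) ⊆ Finset.Icc l (n + 1) := by
    intro i h
    rcases Finset.mem_union.1 h with h | h
    · have := Finset.mem_Icc.1 (hS h)
      exact Finset.mem_Icc.2 (by omega)
    · obtain ⟨k, hk, rfl⟩ := Finset.mem_map.1 h
      have := Finset.mem_Icc.1 (hS hk)
      exact Finset.mem_Icc.2 (by simp only [addRightEmbedding_apply]; omega)
  have h := Finset.card_le_card hsub
  rw [Finset.card_union_of_disjoint hd, Finset.card_map, Nat.card_Icc] at h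
  omega

/-- The generating function of the isolated sets not containing `n`. -/
noncomputable def genWithout (l : ℕ) (y : ℂ) (n j : ℕ) : ℂ :=
  ∑ S ∈ isolatedSets l n with n ∉ S, (descentCoeff n j S : ℂ) * y ^ S.card

/-- The generating function of the isolated sets containing `n`. -/
noncomputable def genWith (l : ℕ) (y : ℂ) (n j : ℕ) : ℂ :=
  ∑ S ∈ isolatedSets l n with n ∈ S, (descentCoeff n j S : ℂ) * y ^ S.card

theorem genWithout_add_genWith (l : ℕ) (y : ℂ) (n j : ℕ) :
    genWithout l y n j + genWith l y n j =
      ∑ S ∈ isolatedSets l n, (descentCoeff n j S : ℂ) * y ^ S.card := by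
  rw [add_comm]
  exact Finset.sum_filter_add_sum_filter_not _ _ _

theorem isolatedSets_of_lt {l n : ℕ} (h : n < l) : isolatedSets l n = {∅} := by
  ext S
  rw [mem_isolatedSets, Finset.Icc_eq_empty (by omega), Finset.subset_empty, Finset.mem_singleton]
  exact and_iff_left_of_imp fun h => by simp [h, Isolated]

theorem genWithout_of_lt {l n j : ℕ} (h : n < l) (hj : j ≤ n) (y : ℂ) :
    genWithout l y n j = if j = 0 then 1 else 0 := by
  rw [genWithout, isolatedSets_of_lt h, Finset.filter_singleton, if_pos (by simp)]
  simp [descentCoeff_empty hj]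

theorem genWith_of_lt {l n : ℕ} (h : n < l) (y : ℂ) (j : ℕ) : genWith l y n j = 0 := by
  rw [genWith, isolatedSets_of_lt h, Finset.filter_singleton, if_neg (by simp), Finset.sum_empty]

theorem isolatedSets_succ_filter {l n : ℕ} :
    (isolatedSets l (n + 1)).filter (n + 1 ∉ ·) = isolatedSets l n := by
  ext S
  simp only [Finset.mem_filter, mem_isolatedSets]
  refine ⟨fun ⟨⟨h, hi⟩, hn⟩ => ⟨fun i hiS => ?_, hi⟩, fun ⟨h, hi⟩ => ⟨⟨?_, hi⟩, fun hn => ?_⟩⟩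
  · have := Finset.mem_Icc.1 (h hiS)
    have : i ≠ n + 1 := fun h => hn (h ▸ hiS)
    exact Finset.mem_Icc.2 (by omega)
  · exact h.trans (Finset.Icc_subset_Icc_right (Nat.le_succ n))
  · have := Finset.mem_Icc.1 (h hn)
    omega

theorem genWithout_succ (l : ℕ) (y : ℂ) (n j : ℕ) :
    genWithout l y (n + 1) j =
      ∑ i ∈ Finset.Ico j (n + 1), (genWithout l y n i + genWith l y n i) := by
  simp only [genWithout_add_genWith]
  rw [genWithout, isolatedSets_succ_filter, Finset.sum_comm]
  refine Finset.sum_congr rfl fun S hS => ?_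
  have hn : n + 1 ∉ S := fun h => by
    have := Finset.mem_Icc.1 ((mem_isolatedSets.1 hS).1 h)
    omega
  rw [descentCoeff_succ_of_notMem hn, Int.cast_sum, Finset.sum_mul]

/-- Isolated sets containing n+1 arise by adding n+1 to isolated sets that avoid n, so only
`genWithout` enters the recursion. -/
theorem genWith_succ {l n : ℕ} (hl : l ≤ n + 1) (y : ℂ) {j : ℕ} (hj : j ≤ n + 1) :
    genWith l y (n + 1) j = y * ∑ i ∈ Finset.range j, genWithout l y n i := by
  have hnot : ∀ S ∈ (isolatedSets l n).filter (n ∉ ·), n + 1 ∉ S := fun S hS h => by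
    have := Finset.mem_Icc.1 ((mem_isolatedSets.1 (Finset.mem_filter.1 hS).1).1 h)
    omega
  simp only [genWithout]
  rw [genWith, Finset.sum_comm, Finset.mul_sum]
  symm
  refine Finset.sum_nbij' (fun S => insert (n + 1) S) (fun S => S.erase (n + 1)) ?_ ?_ ?_ ?_ ?_
  · intro S hS
    have hn1 := hnot S hS
    simp only [Finset.mem_filter, mem_isolatedSets] at hS ⊢
    obtain ⟨⟨h, hi⟩, hn⟩ := hS
    refine ⟨⟨Finset.insert_subset (by simp [hl])
      (h.trans (Finset.Icc_subset_Icc_right (Nat.le_succ n))), fun i hiS hiS' => ?_⟩,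
      Finset.mem_insert_self _ _⟩
    have hle : ∀ k ∈ S, k ≤ n := fun k hk => (Finset.mem_Icc.1 (h hk)).2
    rw [Finset.mem_insert] at hiS hiS'
    rcases hiS with rfl | hiS <;> rcases hiS' with hi' | hiS'
    · omega
    · have := hle _ hiS'; omega
    · exact hn ((show i = n by omega) ▸ hiS)
    · exact hi i hiS hiS'
  · intro S hS
    simp only [Finset.mem_filter, mem_isolatedSets] at hS ⊢
    obtain ⟨⟨h, hi⟩, hn⟩ := hS
    refine ⟨⟨fun i hiS => ?_, hi.mono (Finset.erase_subset _ _)⟩, fun h' => ?_⟩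
    · rw [Finset.mem_erase] at hiS
      have := Finset.mem_Icc.1 (h hiS.2)
      exact Finset.mem_Icc.2 (by omega)
    · exact hi n (Finset.mem_of_mem_erase h') hn
  · intro S hS
    exact Finset.erase_insert (hnot S hS)
  · intro S hS
    exact Finset.insert_erase (Finset.mem_filter.1 hS).2
  · intro S hS
    rw [descentCoeff_succ_insert hj (hnot S hS), Finset.card_insert_of_notMem (hnot S hS),
      Int.cast_sum, Finset.sum_mul, Finset.mul_sum]
    exact Finset.sum_congr rfl fun i _ => by ring

theorem interlaced_gen (l : ℕ) {y : ℂ} (hy : y.im ≠ 0) (n : ℕ) (hl : 1 ≤ l) :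
    Interlaced y (n + 1) (genWithout l y n) (genWith l y n) := by
  -- For n < l the only isolated set is empty, so the `genWith` terms vanish and `genWithout` is 1
  -- at j = 0 and 0 for 0 < j ≤ n; the recursion takes over from rank l.
  have base : ∀ n < l, Interlaced y (n + 1) (genWithout l y n) (genWith l y n) := by
    intro n h
    have hA : ∀ i k, i ≤ k → k < n + 1 → Precedes y (genWithout l y n i) (genWithout l y n k) := by
      intro i k hik hk
      rcases hik.eq_or_lt with rfl | hik
      · exact Precedes.refl _ _
      · rw [genWithout_of_lt h (j := k) (by omega), if_neg (by omega)]
        exact Precedes.zero_right _ _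
    refine ⟨hA, fun i k _ _ => ?_, fun i k hik hk => ?_, ?_⟩
    · rw [genWith_of_lt h]
      exact Precedes.zero_right _ _
    · simpa [genWith_of_lt h] using hA i k hik hk
    · simp [genWith_of_lt h, genWithout_of_lt h]
  induction n with
  | zero => exact base 0 hl
  | succ n ih =>
    rcases lt_or_ge (n + 1) l with h | h
    · exact base _ h
    · exact ih.step hy (fun j _ => genWithout_succ l y n j) (fun j hj => genWith_succ h y hj)

open scoped ComplexOrder in
theorem gen_nonneg (l : ℕ) {y : ℂ} (hy : 0 < y) (n : ℕ) (hl : 1 ≤ l) :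
    (∀ j ≤ n, 0 ≤ genWithout l y n j ∧ 0 ≤ genWith l y n j) ∧ 0 < genWithout l y n 0 := by
  have base : ∀ n < l, (∀ j ≤ n, 0 ≤ genWithout l y n j ∧ 0 ≤ genWith l y n j) ∧
      0 < genWithout l y n 0 := by
    intro n h
    refine ⟨fun j hj => ?_, ?_⟩
    · rw [genWithout_of_lt h hj, genWith_of_lt h]
      refine ⟨?_, le_rfl⟩
      split_ifs <;> simp
    · rw [genWithout_of_lt h (Nat.zero_le n)]
      simp
  induction n with
  | zero => exact base 0 hl
  | succ n ih =>
    rcases lt_or_ge (n + 1) l with h | h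
    · exact base _ h
    · have hG : ∀ i ≤ n, 0 ≤ genWithout l y n i + genWith l y n i := fun i hi =>
        add_nonneg (ih.1 i hi).1 (ih.1 i hi).2
      refine ⟨fun j hj => ⟨?_, ?_⟩, ?_⟩
      · rw [genWithout_succ]
        exact Finset.sum_nonneg fun i hi => hG i (by have := Finset.mem_Ico.1 hi; omega)
      · rw [genWith_succ h y hj]
        exact mul_nonneg hy.le (Finset.sum_nonneg fun i hi =>
          (ih.1 i (by have := Finset.mem_range.1 hi; omega)).1)
      · rw [genWithout_succ]
        refine Finset.sum_pos' (fun i hi => hG i (by have := Finset.mem_Ico.1 hi; omega))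
          ⟨0, by simp, add_pos_of_pos_of_nonneg ih.2 (ih.1 0 (Nat.zero_le n)).2⟩

/-! ### From nonvanishing to real-rootedness -/

theorem im_eq_zero_of_eq_neg_mul {z : ℂ} {r : ℝ} (hr : 0 ≤ r) (h : z = -r * (1 + z) ^ 2) :
    z.im = 0 := by
  by_contra hz
  have hre := congrArg Complex.re h
  have him := congrArg Complex.im h
  simp [pow_two] at hre him
  -- Dividing the imaginary part by z.im ≠ 0 forces 1 + z.re < 0, while with this relation the real
  -- part gives (1 + z.re)/2 = 1 + r z.im² > 0.
  have h1 : 1 = -(2 * r * (1 + z.re)) := by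
    apply mul_left_cancel₀ hz
    linarith
  have h2 := mul_nonneg hr (sq_nonneg z.im)
  have h3 := mul_nonneg hr (sq_nonneg (1 + z.re))
  have h4 : r * (1 + z.re) ^ 2 = -(1 + z.re) / 2 := by
    linear_combination ((1 + z.re) / 2) * h1
  nlinarith

open scoped ComplexOrder in
theorem gen_sum_ne_zero {l : ℕ} (hl : 1 ≤ l) {y : ℂ} (hy : y.im ≠ 0 ∨ 0 < y) {n : ℕ} {r : ℕ → ℝ}
    (hr : ∀ j ≤ n, 0 ≤ r j) (hr0 : r 0 = 1) :
    ∑ j ∈ Finset.range (n + 1), (r j : ℂ) * (genWithout l y n j + genWith l y n j) ≠ 0 := by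
  rcases hy with hy | hy
  · exact (interlaced_gen l hy n hl).sum_ne_zero hy hr hr0
  · obtain ⟨h, h0⟩ := gen_nonneg l hy n hl
    refine (Finset.sum_pos' (fun j hj => ?_) ⟨0, by simp, ?_⟩).ne'
    · have hj : j ≤ n := by have := Finset.mem_range.1 hj; omega
      exact mul_nonneg (Complex.zero_le_real.2 (hr j hj)) (add_nonneg (h j hj).1 (h j hj).2)
    · rw [hr0, Complex.ofReal_one, one_mul]
      exact add_pos_of_pos_of_nonneg h0 (h 0 (Nat.zero_le n)).2

theorem realRooted_sum_isolatedSets {P : Type*} [PartialOrder P] [OrderBot P] [Finite P] {n : ℕ}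
    (hP : IsGradedSimplicial P n) (hpos : ∀ i ≤ n, 0 ≤ hVector P n i) {l : ℕ} (hl : 1 ≤ l) :
    RealRooted (∑ S ∈ isolatedSets l n,
      C (flagH (WithTop P) S : ℝ) * X ^ S.card * (1 + X) ^ (n + 2 - l - 2 * S.card)) := by
  intro z hz
  by_contra him
  have h1z : 1 + z ≠ 0 := fun h => him (by simpa using congrArg Complex.im h)
  set y := z / (1 + z) ^ 2 with hy
  have hzy : z = y * (1 + z) ^ 2 := by rw [hy]; field_simp
  open scoped ComplexOrder in
  have hycases : y.im ≠ 0 ∨ 0 < y := by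
    by_contra! hcon
    obtain ⟨hyim, hy0⟩ := hcon
    have hyre : y.re ≤ 0 := by
      by_contra! h
      exact hy0 (Complex.pos_iff.2 ⟨h, hyim.symm⟩)
    refine him (im_eq_zero_of_eq_neg_mul (r := -y.re) (by linarith) ?_)
    rw [Complex.ofReal_neg, neg_neg, show (y.re : ℂ) = y from Complex.ext rfl (by simp [hyim])]
    exact hzy
  refine gen_sum_ne_zero hl hycases (r := fun j => (hVector P n j : ℝ))
    (fun j hj => by exact_mod_cast hpos j hj) (by simp [hVector_zero]) ?_
  -- The exponent n + 2 - l is n for the Chow polynomial (l = 2) and n + 1 for the augmented one (l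
  -- = 1).
  refine (mul_eq_zero.1 (?_ : (1 + z) ^ (n + 2 - l) * _ = 0)).resolve_left (pow_ne_zero _ h1z)
  rw [← hz, map_sum]
  simp only [genWithout_add_genWith, Finset.mul_sum]
  rw [Finset.sum_comm]
  refine Finset.sum_congr rfl fun S hS => ?_
  have hS1 : S ⊆ Finset.Icc 1 n :=
    (mem_isolatedSets.1 hS).1.trans (Finset.Icc_subset_Icc_left hl)
  obtain ⟨d, hd⟩ := Nat.exists_eq_add_of_le (two_mul_card_le_of_isolated hS)
  have hpow : (1 + z) ^ (n + 2 - l) * y ^ S.card = z ^ S.card * (1 + z) ^ d := by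
    rw [hd, pow_add, pow_mul]
    nth_rewrite 3 [hzy]
    rw [mul_pow]
    ring
  rw [hP.flagH_eq_sum hS1, hd, Nat.add_sub_cancel_left, ← hd]
  simp only [map_mul, map_pow, map_add, map_one, aeval_X, aeval_C, Complex.coe_algebraMap,
    Int.cast_sum, Int.cast_mul, Complex.ofReal_sum, Complex.ofReal_mul, Complex.ofReal_intCast]
  rw [mul_assoc, ← hpow, Finset.sum_mul]
  exact Finset.sum_congr rfl fun j _ => by ring

end ChowPoset

theorem theorem1 {P : Type*} [PartialOrder P] [OrderBot P] [Finite P] (n : ℕ)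
    (hP : ChowPoset.IsGradedSimplicial P n)
    (hpos : ∀ i ≤ n, 0 ≤ ChowPoset.hVector P n i) :
    ChowPoset.RealRooted (ChowPoset.chowPolynomial (WithTop P) n) ∧
      ChowPoset.RealRooted (ChowPoset.augChowPolynomial (WithTop P) n) :=
  ⟨ChowPoset.realRooted_sum_isolatedSets hP hpos one_le_two,
    ChowPoset.realRooted_sum_isolatedSets hP hpos le_rfl⟩
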